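/- Let $n\ge 1$, let $\Omega\subset\mathbb{R}^n$ be a bounded, open, convex set, and put $D=\operatorname{diam}(\Omega)$. Let $\Omega_\delta\subset\overline{\Omega}$ be a nonempty open convex polyhedron (a finite intersection of open half-spaces) whose vertices lie on $\partial\Omega$. For a facet $F$ of $\Omega_\delta$ let $\vec n_F$ be its outward unit normal and $\vec g_F$ its barycenter, let $\mathcal F_\delta$ be the set of all facets of $\Omega_\delta$, and define the gap $$\delta=\max_{F\in\mathcal F_\delta}\ \max_{x\in\partial\Omega}\ \vec n_F\cdot(x-\vec g_F).$$ Let $f\in L^\infty(\Omega)$. Let $u\in H^1_0(\Omega)$ be the weak solution of $-\Delta u=f$ in $\Omega$, $u=0$ on $\partial\Omega$, that is, $\int_\Omega\nabla u\cdot\nabla w\,dx=\int_\Omega fw\,dx$ for all $w\in H^1_0(\Omega)$. Let $v\in H^1_0(\Omega_\delta)$ be the weak solution of $-\Delta v=f$ in $\Omega_\delta$, $v=0$ on $\partial\Omega_\delta$, that is, $\int_{\Omega_\delta}\nabla v\cdot\nabla w\,dx=\int_{\Omega_\delta} fw\,dx$ for all $w\in H^1_0(\Omega_\delta)$, and extend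 $v$ by zero outside $\Omega_\delta$. Then $$\|u-v\|_{L^\infty(\Omega)}\le \tfrac12\,D\,\delta\,\|f\|_{L^\infty(\Omega)}.$$ -/

import Mathlib

open MeasureTheory
open scoped ContDiff ENNReal RealInnerProductSpace

noncomputable section

namespace PoissonGap

/-- Test functions on an open set `U`: the space `C_c^∞(U)`. -/
structure IsTestFunction {n : ℕ} (U : Set (EuclideanSpace ℝ (Fin n)))
    (φ : EuclideanSpace ℝ (Fin n) → ℝ) : Prop where
  smooth : ContDiff ℝ ∞ φ
  compact_support : HasCompactSupport φ
  support_subset : tsupport φ ⊆ U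

/-- `u ∈ H¹(U)` with weak gradient `G`: both are square integrable on `U`, and
`∫_U u ∇φ = - ∫_U φ G` (an identity of vectors) for all `φ ∈ C_c^∞(U)`. -/
structure IsH1With {n : ℕ} (U : Set (EuclideanSpace ℝ (Fin n)))
    (u : EuclideanSpace ℝ (Fin n) → ℝ)
    (G : EuclideanSpace ℝ (Fin n) → EuclideanSpace ℝ (Fin n)) : Prop where
  memLp : MemLp u 2 (volume.restrict U)
  memLp_grad : MemLp G 2 (volume.restrict U)
  weak_gradient : ∀ φ : EuclideanSpace ℝ (Fin n) → ℝ, IsTestFunction U φ →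
    ∫ x in U, u x • gradient φ x = - ∫ x in U, φ x • G x

/-- `u ∈ H¹₀(U)` with weak gradient `G`: `u` lies in `H¹(U)` and in the closure of `C_c^∞(U)`
for the `H¹(U)` norm. -/
structure IsH10With {n : ℕ} (U : Set (EuclideanSpace ℝ (Fin n)))
    (u : EuclideanSpace ℝ (Fin n) → ℝ)
    (G : EuclideanSpace ℝ (Fin n) → EuclideanSpace ℝ (Fin n)) : Prop
    extends IsH1With U u G where
  approx : ∀ ε : ℝ≥0∞, 0 < ε → ∃ φ : EuclideanSpace ℝ (Fin n) → ℝ, IsTestFunction U φ ∧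
    eLpNorm (fun x => u x - φ x) 2 (volume.restrict U) < ε ∧
    eLpNorm (fun x => G x - gradient φ x) 2 (volume.restrict U) < ε

/-- `u` is a weak solution of `-Δu = f` in `U`, `u = 0` on `∂U`:
`u ∈ H¹₀(U)` and `∫_U ∇u · ∇w = ∫_U f w` for all `w ∈ H¹₀(U)`. -/
def IsWeakSolution {n : ℕ} (U : Set (EuclideanSpace ℝ (Fin n)))
    (f u : EuclideanSpace ℝ (Fin n) → ℝ) : Prop :=
  ∃ G : EuclideanSpace ℝ (Fin n) → EuclideanSpace ℝ (Fin n), IsH10With U u G ∧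
    ∀ (w : EuclideanSpace ℝ (Fin n) → ℝ)
      (H : EuclideanSpace ℝ (Fin n) → EuclideanSpace ℝ (Fin n)), IsH10With U w H →
      ∫ x in U, ⟪G x, H x⟫ = ∫ x in U, f x * w x

/-- A nonempty open convex polyhedron: a finite intersection of open half-spaces. -/
def IsOpenConvexPolyhedron {n : ℕ} (P : Set (EuclideanSpace ℝ (Fin n))) : Prop :=
  P.Nonempty ∧ ∃ s : Finset (EuclideanSpace ℝ (Fin n) × ℝ),
    (∀ h ∈ s, h.1 ≠ 0) ∧ P = {x | ∀ h ∈ s, ⟪h.1, x⟫ < h.2}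

/-- An open convex polyhedron `P ⊆ closure Ω` all of whose vertices (the extreme points of its
closure) lie on `∂Ω`. -/
structure IsInscribedPolyhedron {n : ℕ} (Ω P : Set (EuclideanSpace ℝ (Fin n))) : Prop where
  polyhedron : IsOpenConvexPolyhedron P
  subset_closure : P ⊆ closure Ω
  vertices_subset : (closure P).extremePoints ℝ ⊆ frontier Ω

/-- `F` is a facet of `P` with outward unit normal `ν`: `F` is the face of `closure P` on which
the linear functional `⟪ν, ·⟫` is maximal, and `F` has dimension `n - 1`. -/
structure IsFacet {n : ℕ} (P F : Set (EuclideanSpace ℝ (Fin n)))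
    (ν : EuclideanSpace ℝ (Fin n)) : Prop where
  norm_normal : ‖ν‖ = 1
  eq_face : F = {x | x ∈ closure P ∧ ∀ y ∈ closure P, ⟪ν, y⟫ ≤ ⟪ν, x⟫}
  nonempty : F.Nonempty
  dim_eq : Module.finrank ℝ (vectorSpan ℝ F) + 1 = n

/-- The barycenter of a facet: the mean of `x` over `F` for `(n-1)`-dimensional Hausdorff
measure. -/
def barycenter {n : ℕ} (F : Set (EuclideanSpace ℝ (Fin n))) : EuclideanSpace ℝ (Fin n) :=
  ⨍ x in F, x ∂(Measure.hausdorffMeasure ((n : ℝ) - 1))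

/-- The gap: the largest value of `ν_F · (x - g_F)` over the facets `F` of `P` (with outward unit
normal `ν_F` and barycenter `g_F`) and the points `x ∈ ∂Ω`. -/
def gap {n : ℕ} (Ω P : Set (EuclideanSpace ℝ (Fin n))) : ℝ :=
  sSup {t | ∃ F ν, IsFacet P F ν ∧ ∃ x ∈ frontier Ω, t = ⟪ν, x - barycenter F⟫}

/-- Extension of a function on `U` by zero. -/
def zeroExtend {n : ℕ} (U : Set (EuclideanSpace ℝ (Fin n)))
    (a : EuclideanSpace ℝ (Fin n) → ℝ) : EuclideanSpace ℝ (Fin n) → ℝ :=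
  U.indicator a

end PoissonGap

end

/-!
The proof is a comparison argument, in the weak form that `H¹₀` functions require.

*Barrier.* Let a set lie in the strip `0 ≤ s ≤ D`, where `s = m - ⟪ν, x⟫` and `‖ν‖ = 1`. Then
`C / 2 * s * (D - s)` is nonnegative on the set and its Laplacian is `-C`, so it dominates every
weak solution with right-hand side at most `C`; hence the solution is at most `C / 2 * D * s`
(`IsWeakSolution.ae_le_barrier`). For a facet of `P` with normal `ν`, let `h` be the value of
`⟪ν, ·⟫` on the facet and `m` its maximum on `closure Ω`. The maximum is attained on `∂Ω` and the
barycenter lies in the facet, so `m - h` is at most the gap `δ`. Beyond the facet this gives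
`u ≤ C / 2 * D * δ`, and near the facet it gives the same up to a small error. The barrier applied
to `-v` on `P` shows that `-v` is small near the facets.

*Comparison.* Every point of `Ω` outside `P` is beyond some facet of `P`, because a polyhedron is
the intersection of the half-spaces of its facets (`IsOpenConvexPolyhedron.exists_facets`). So with
`c = C / 2 * D * (δ + 2 * η)` the inequality `u ≤ v + c` holds outside a compact subset of `P`, and
testing both equations with a smooth version of `(u - v - c)⁺` carries it over to all of `P`
(`IsWeakSolution.ae_le_add_of_ae_le_add_off_compact`). Letting `η → 0`, and exchanging the signs of
`f`, `u`, `v`, gives the theorem. Because the inequality is known up to a neighbourhood of `∂P`, no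
traces and no regularity of the solutions are needed.

*Truncation.* In the place of the positive part stands `θ = expNegInvGlue`, which is smooth,
vanishes exactly on `(-∞, 0]` and has a bounded nonnegative derivative; so `θ` of a test function,
suitably cut off, is again a test function. The chain rule for limits of smooth functions is
`SmoothApprox.comp`. The energy identity then says that `θ (w)` has gradient zero, and integration
by parts against a linear function, instead of the Poincaré inequality, that it vanishes
(`IsH10With.ae_eq_zero_of_grad_ae_eq_zero`).
-/

namespace PoissonGap

open Filter Set
open scoped Topology

/-! ### Gradients of smooth functions -/

section Gradient

variable {E : Type*} [NormedAddCommGroup E] [InnerProductSpace ℝ E] [CompleteSpace E]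

lemma gradient_sub {a b : E → ℝ} {x : E} (ha : DifferentiableAt ℝ a x)
    (hb : DifferentiableAt ℝ b x) :
    gradient (fun y => a y - b y) x = gradient a x - gradient b x := by
  simp only [gradient]
  rw [show (fun y => a y - b y) = a - b from rfl, fderiv_sub ha hb, map_sub]

lemma gradient_mul {a b : E → ℝ} {x : E} (ha : DifferentiableAt ℝ a x)
    (hb : DifferentiableAt ℝ b x) :
    gradient (fun y => a y * b y) x = a x • gradient b x + b x • gradient a x := by
  simp only [gradient]
  rw [show (fun y => a y * b y) = a * b from rfl, fderiv_mul ha hb]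
  simp

lemma gradient_comp {θ : ℝ → ℝ} {w : E → ℝ} {x : E} (hθ : DifferentiableAt ℝ θ (w x))
    (hw : DifferentiableAt ℝ w x) :
    gradient (fun y => θ (w y)) x = deriv θ (w x) • gradient w x := by
  refine ext_inner_right ℝ fun v => ?_
  rw [inner_smul_left, inner_gradient_left, inner_gradient_left,
    show (fun y => θ (w y)) = θ ∘ w from rfl, fderiv_comp x hθ hw]
  simp [mul_comm]

lemma continuous_gradient {w : E → ℝ} (hw : ContDiff ℝ ∞ w) : Continuous (gradient w) := by
  unfold gradient
  exact (LinearIsometryEquiv.continuous _).comp (hw.continuous_fderiv (by simp))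

lemma hasCompactSupport_gradient {w : E → ℝ} (hw : HasCompactSupport w) :
    HasCompactSupport (gradient w) := by
  have h := hw.fderiv (𝕜 := ℝ)
  exact h.comp_left (g := (InnerProductSpace.toDual ℝ E).symm) (map_zero _)

end Gradient

/-! ### Convergence in `L²` -/

section Convergence

variable {α F F₁ F₂ F₃ : Type*} [MeasurableSpace α] {μ : Measure α}
  [NormedAddCommGroup F] [NormedAddCommGroup F₁] [NormedAddCommGroup F₂] [NormedAddCommGroup F₃]

lemma tendsto_eLpNorm_zero_of_dominated {g : ℕ → α → F} {G : α → F₁}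
    (hg : ∀ k, AEStronglyMeasurable (g k) μ) (hG : MemLp G 2 μ) (C : ℝ)
    (hle : ∀ k, ∀ᵐ x ∂μ, ‖g k x‖ ≤ C * ‖G x‖)
    (hlim : ∀ᵐ x ∂μ, Tendsto (fun k => g k x) atTop (𝓝 0)) :
    Tendsto (fun k => eLpNorm (g k) 2 μ) atTop (𝓝 0) := by
  have h2 : ∀ k, eLpNorm (g k) 2 μ = (∫⁻ x, ‖g k x‖ₑ ^ (2 : ℝ) ∂μ) ^ (1 / (2 : ℝ)) := fun k => by
    rw [eLpNorm_eq_lintegral_rpow_enorm_toReal (by norm_num) (by norm_num)]; simp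
  have hCG : MemLp (fun x => C * ‖G x‖) 2 μ := hG.norm.const_mul C
  have key : Tendsto (fun k => ∫⁻ x, ‖g k x‖ₑ ^ (2 : ℝ) ∂μ) atTop (𝓝 (∫⁻ _, 0 ∂μ)) := by
    refine tendsto_lintegral_of_dominated_convergence' (fun x => ‖C * ‖G x‖‖ₑ ^ (2 : ℝ))
      (fun k => (hg k).enorm.pow_const _) (fun k => ?_) ?_ ?_
    · filter_upwards [hle k] with x hx
      refine ENNReal.rpow_le_rpow ?_ (by norm_num)
      rw [← ofReal_norm, ← ofReal_norm]
      exact ENNReal.ofReal_le_ofReal (hx.trans (le_abs_self _))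
    · have := lintegral_rpow_enorm_lt_top_of_eLpNorm_lt_top (by norm_num) (by norm_num) hCG.2
      simpa using this.ne
    · filter_upwards [hlim] with x hx
      have h1 : Tendsto (fun k => ‖g k x‖ₑ) atTop (𝓝 0) := by simpa using hx.enorm
      have := (ENNReal.continuous_rpow_const (y := (2 : ℝ))).continuousAt.tendsto.comp h1
      simpa [Function.comp_def] using this
  simp only [h2]
  have := (ENNReal.continuous_rpow_const (y := 1 / (2 : ℝ))).continuousAt.tendsto.comp key
  simpa [Function.comp_def] using this

/-- `L²` convergence passes to the limit in `∫ b (h, g)` for a fixed `g ∈ L²` and a bounded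
bilinear `b`. -/
lemma tendsto_integral_bilin [NormedSpace ℝ F₁] [NormedSpace ℝ F₂] [NormedSpace ℝ F₃]
    (b : F₁ →L[ℝ] F₂ →L[ℝ] F₃) {h : α → F₁} {hk : ℕ → α → F₁} {g : α → F₂}
    (hh : MemLp h 2 μ) (hhk : ∀ k, AEStronglyMeasurable (hk k) μ)
    (hlim : Tendsto (fun k => eLpNorm (fun x => h x - hk k x) 2 μ) atTop (𝓝 0))
    (hg : MemLp g 2 μ) :
    Tendsto (fun k => ∫ x, b (hk k x) (g x) ∂μ) atTop (𝓝 (∫ x, b (h x) (g x) ∂μ)) := by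
  have hbd : ∀ (k : F₁) (l : F₂), ‖b k l‖₊ ≤ ‖b‖₊ * ‖k‖₊ * ‖l‖₊ := fun k l => b.le_opNorm₂ k l
  have hmeas : ∀ {r : α → F₁}, AEStronglyMeasurable r μ →
      AEStronglyMeasurable (fun x => b (r x) (g x)) μ := fun hr =>
    b.aestronglyMeasurable_comp₂ hr hg.1
  have hle : ∀ k, eLpNorm ((fun x => b (hk k x) (g x)) - fun x => b (h x) (g x)) 1 μ ≤
      ‖b‖₊ * eLpNorm (fun x => h x - hk k x) 2 μ * eLpNorm g 2 μ := fun k => by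
    have := eLpNorm_le_eLpNorm_mul_eLpNorm_of_nnnorm (p := 2) (q := 2) (r := 1)
      (hh.1.sub (hhk k)) hg.1 (fun x y => b x y) ‖b‖₊ (Eventually.of_forall fun x => hbd _ _)
    refine le_trans (le_of_eq ?_) this
    rw [← eLpNorm_neg]
    congr 1
    ext x
    simp
  have hz : Tendsto (fun k => ‖b‖₊ * eLpNorm (fun x => h x - hk k x) 2 μ * eLpNorm g 2 μ)
      atTop (𝓝 0) := by
    have := ENNReal.Tendsto.mul_const (b := eLpNorm g 2 μ)
      (ENNReal.Tendsto.const_mul (a := (‖b‖₊ : ℝ≥0∞)) hlim (Or.inr (by simp)))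
      (Or.inr hg.2.ne)
    simpa using this
  have hL1 := tendsto_of_tendsto_of_tendsto_of_le_of_le tendsto_const_nhds hz
    (fun _ => zero_le) hle
  refine tendsto_integral_of_L1' _ (hmeas hh.1) ?_ hL1
  have hI : Integrable (fun x => b (h x) (g x)) μ :=
    memLp_one_iff_integrable.1 (hh.of_bilin (fun x y => b x y) ‖b‖₊ hg (hmeas hh.1)
      (Eventually.of_forall fun x => hbd _ _))
  filter_upwards [hz.eventually_lt_const (show (0 : ℝ≥0∞) < ⊤ by simp)] with k hk'
  have : MemLp ((fun x => b (hk k x) (g x)) - fun x => b (h x) (g x)) 1 μ :=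
    ⟨(hmeas (hhk k)).sub (hmeas hh.1), (hle k).trans_lt hk'⟩
  have h3 := (memLp_one_iff_integrable.1 this).add hI
  simpa using h3

end Convergence

section Sobolev

variable {n : ℕ} {U V : Set (EuclideanSpace ℝ (Fin n))}

/-! ### Test functions -/

lemma IsTestFunction.memLp {φ : EuclideanSpace ℝ (Fin n) → ℝ} (h : IsTestFunction U φ) :
    MemLp φ 2 volume :=
  h.smooth.continuous.memLp_of_hasCompactSupport h.compact_support

lemma IsTestFunction.memLp_gradient {φ : EuclideanSpace ℝ (Fin n) → ℝ}
    (h : IsTestFunction U φ) : MemLp (gradient φ) 2 volume :=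
  (continuous_gradient h.smooth).memLp_of_hasCompactSupport
    (hasCompactSupport_gradient h.compact_support)

lemma IsTestFunction.mono {φ : EuclideanSpace ℝ (Fin n) → ℝ} (h : IsTestFunction U φ)
    (hUV : U ⊆ V) : IsTestFunction V φ :=
  ⟨h.smooth, h.compact_support, h.support_subset.trans hUV⟩

lemma IsTestFunction.eq_zero {φ : EuclideanSpace ℝ (Fin n) → ℝ} (h : IsTestFunction U φ)
    {x : EuclideanSpace ℝ (Fin n)} (hx : x ∉ U) : φ x = 0 :=
  image_eq_zero_of_notMem_tsupport fun h' => hx (h.support_subset h')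

lemma IsTestFunction.gradient_eq_zero {φ : EuclideanSpace ℝ (Fin n) → ℝ}
    (h : IsTestFunction U φ) {x : EuclideanSpace ℝ (Fin n)} (hx : x ∉ U) : gradient φ x = 0 := by
  have h1 : φ =ᶠ[𝓝 x] fun _ => (0 : ℝ) :=
    notMem_tsupport_iff_eventuallyEq.1 fun h' => hx (h.support_subset h')
  rw [h1.gradient_eq, gradient_fun_const]

lemma IsTestFunction.neg {φ : EuclideanSpace ℝ (Fin n) → ℝ} (h : IsTestFunction U φ) :
    IsTestFunction U (fun x => -φ x) := by
  refine ⟨h.smooth.neg, h.compact_support.neg, ?_⟩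
  have : tsupport (fun x => -φ x) = tsupport φ := by
    simp [tsupport, Function.support_fun_neg]
  rw [this]
  exact h.support_subset

/-- Integration by parts of a test function against a differentiable function, along one
direction. -/
lemma IsTestFunction.integral_mul_inner_gradient {φ a : EuclideanSpace ℝ (Fin n) → ℝ}
    (h : IsTestFunction U φ) (ha : ContDiff ℝ ∞ a) (e : EuclideanSpace ℝ (Fin n)) :
    ∫ x in U, a x * ⟪e, gradient φ x⟫ = - ∫ x in U, fderiv ℝ a x e * φ x := by
  rw [setIntegral_eq_integral_of_forall_compl_eq_zero
      (fun x hx => by simp [h.gradient_eq_zero hx]),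
    setIntegral_eq_integral_of_forall_compl_eq_zero (fun x hx => by simp [h.eq_zero hx])]
  have hd : Continuous fun x => fderiv ℝ a x e :=
    (ha.continuous_fderiv (by simp)).clm_apply continuous_const
  have hd' : Continuous fun x => fderiv ℝ φ x e :=
    (h.smooth.continuous_fderiv (by simp)).clm_apply continuous_const
  have h0 : ∀ x, ⟪e, gradient φ x⟫ = fderiv ℝ φ x e := fun x => by
    rw [real_inner_comm, inner_gradient_left]
  simp only [h0]
  refine integral_mul_fderiv_eq_neg_fderiv_mul_of_integrable ?_ ?_ ?_
    (fun x _ => (ha.differentiable (by simp)).differentiableAt)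
    (fun x _ => (h.smooth.differentiable (by simp)).differentiableAt)
  · exact (hd.mul h.smooth.continuous).integrable_of_hasCompactSupport h.compact_support.mul_left
  · exact (ha.continuous.mul hd').integrable_of_hasCompactSupport
      (HasCompactSupport.mul_left (h.compact_support.fderiv_apply (𝕜 := ℝ) e))
  · exact (ha.continuous.mul h.smooth.continuous).integrable_of_hasCompactSupport
      h.compact_support.mul_left

lemma IsTestFunction.integral_smul_gradient {φ ψ : EuclideanSpace ℝ (Fin n) → ℝ}
    (hφ : IsTestFunction U φ) (hψ : IsTestFunction U ψ) :
    ∫ x in U, ψ x • gradient φ x = - ∫ x in U, φ x • gradient ψ x := by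
  have hI : ∀ {φ ψ : EuclideanSpace ℝ (Fin n) → ℝ}, IsTestFunction U φ → IsTestFunction U ψ →
      Integrable (fun x => ψ x • gradient φ x) (volume.restrict U) := fun h h' =>
    ((h'.smooth.continuous.smul (continuous_gradient h.smooth)).integrable_of_hasCompactSupport
      h'.compact_support.smul_right).restrict
  refine ext_inner_left ℝ fun e => ?_
  rw [inner_neg_right, ← integral_inner (hI hφ hψ), ← integral_inner (hI hψ hφ)]
  simp only [inner_smul_right]
  rw [hφ.integral_mul_inner_gradient hψ.smooth e]
  congr 1
  refine integral_congr_ae (Eventually.of_forall fun x => ?_)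
  simp only
  rw [real_inner_comm, inner_gradient_left, mul_comm]

/-! ### Approximation by smooth functions -/

/-- The smooth functions `wk k` approximate `w` in `L²(U)`, and their gradients approximate `W`
in `L²(U)`; nothing is asked of them outside `U` or at the boundary of `U`. -/
structure SmoothApprox (U : Set (EuclideanSpace ℝ (Fin n)))
    (w : EuclideanSpace ℝ (Fin n) → ℝ)
    (W : EuclideanSpace ℝ (Fin n) → EuclideanSpace ℝ (Fin n))
    (wk : ℕ → EuclideanSpace ℝ (Fin n) → ℝ) : Prop where
  memLp : MemLp w 2 (volume.restrict U)
  memLp_grad : MemLp W 2 (volume.restrict U)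
  smooth : ∀ k, ContDiff ℝ ∞ (wk k)
  tendsto : Tendsto (fun k => eLpNorm (fun x => w x - wk k x) 2 (volume.restrict U)) atTop (𝓝 0)
  tendsto_grad : Tendsto (fun k => eLpNorm (fun x => W x - gradient (wk k) x) 2
    (volume.restrict U)) atTop (𝓝 0)

lemma IsH10With.exists_smoothApprox {u : EuclideanSpace ℝ (Fin n) → ℝ}
    {G : EuclideanSpace ℝ (Fin n) → EuclideanSpace ℝ (Fin n)} (h : IsH10With U u G) :
    ∃ φ : ℕ → EuclideanSpace ℝ (Fin n) → ℝ, (∀ k, IsTestFunction U (φ k)) ∧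
      SmoothApprox U u G φ := by
  obtain ⟨ε, -, hε, hlim⟩ := exists_seq_strictAnti_tendsto' (show (0 : ℝ≥0∞) < 1 by simp)
  choose φ hφ h1 h2 using fun k => h.approx (ε k) (hε k).1
  exact ⟨φ, hφ, h.memLp, h.memLp_grad, fun k => (hφ k).smooth,
    tendsto_of_tendsto_of_tendsto_of_le_of_le tendsto_const_nhds hlim
      (fun _ => zero_le) (fun k => (h1 k).le),
    tendsto_of_tendsto_of_tendsto_of_le_of_le tendsto_const_nhds hlim
      (fun _ => zero_le) (fun k => (h2 k).le)⟩

/-- `H¹₀(U)` is closed: a limit of functions that coincide on `U` with test functions is in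
`H¹₀(U)`. -/
lemma SmoothApprox.isH10With (hU : IsOpen U) {w : EuclideanSpace ℝ (Fin n) → ℝ}
    {W : EuclideanSpace ℝ (Fin n) → EuclideanSpace ℝ (Fin n)}
    {wk ψ : ℕ → EuclideanSpace ℝ (Fin n) → ℝ} (h : SmoothApprox U w W wk)
    (hψ : ∀ k, IsTestFunction U (ψ k)) (heq : ∀ k, ∀ x ∈ U, ψ k x = wk k x) :
    IsH10With U w W := by
  have hgr : ∀ k, ∀ x ∈ U, gradient (ψ k) x = gradient (wk k) x := fun k x hx =>
    Filter.EventuallyEq.gradient_eq (by filter_upwards [hU.mem_nhds hx] with y hy using heq k y hy)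
  have hae : ∀ᵐ x ∂(volume.restrict U), x ∈ U := ae_restrict_mem hU.measurableSet
  have t1 : Tendsto (fun k => eLpNorm (fun x => w x - ψ k x) 2 (volume.restrict U)) atTop
      (𝓝 0) := by
    refine h.tendsto.congr fun k => eLpNorm_congr_ae ?_
    filter_upwards [hae] with x hx
    rw [heq k x hx]
  have t2 : Tendsto (fun k => eLpNorm (fun x => W x - gradient (ψ k) x) 2 (volume.restrict U))
      atTop (𝓝 0) := by
    refine h.tendsto_grad.congr fun k => eLpNorm_congr_ae ?_
    filter_upwards [hae] with x hx
    rw [hgr k x hx]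
  refine ⟨⟨h.memLp, h.memLp_grad, fun φ hφ => ?_⟩, fun ε hε => ?_⟩
  · have l1 := tendsto_integral_bilin (ContinuousLinearMap.lsmul ℝ ℝ) h.memLp
      (fun k => (hψ k).smooth.continuous.aestronglyMeasurable) t1 (hφ.memLp_gradient.restrict U)
    have l2 := tendsto_integral_bilin (ContinuousLinearMap.lsmul ℝ ℝ).flip h.memLp_grad
      (fun k => (continuous_gradient (hψ k).smooth).aestronglyMeasurable) t2 (hφ.memLp.restrict U)
    simp only [ContinuousLinearMap.flip_apply, ContinuousLinearMap.lsmul_apply] at l1 l2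
    refine tendsto_nhds_unique l1 (l2.neg.congr fun k => ?_)
    rw [hφ.integral_smul_gradient (hψ k)]
  · obtain ⟨k, h1, h2⟩ := ((t1.eventually_lt_const hε).and (t2.eventually_lt_const hε)).exists
    exact ⟨ψ k, hψ k, h1, h2⟩

lemma SmoothApprox.mono {w : EuclideanSpace ℝ (Fin n) → ℝ}
    {W : EuclideanSpace ℝ (Fin n) → EuclideanSpace ℝ (Fin n)}
    {wk : ℕ → EuclideanSpace ℝ (Fin n) → ℝ} (h : SmoothApprox U w W wk) (hVU : V ⊆ U) :
    SmoothApprox V w W wk := by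
  have hle := Measure.restrict_mono_set (volume : Measure (EuclideanSpace ℝ (Fin n))) hVU
  exact ⟨h.memLp.mono_measure hle, h.memLp_grad.mono_measure hle, h.smooth,
    tendsto_of_tendsto_of_tendsto_of_le_of_le tendsto_const_nhds h.tendsto
      (fun _ => zero_le) (fun k => eLpNorm_mono_measure _ hle),
    tendsto_of_tendsto_of_tendsto_of_le_of_le tendsto_const_nhds h.tendsto_grad
      (fun _ => zero_le) (fun k => eLpNorm_mono_measure _ hle)⟩

lemma SmoothApprox.const {w : EuclideanSpace ℝ (Fin n) → ℝ} (hw : ContDiff ℝ ∞ w)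
    (h : MemLp w 2 (volume.restrict U)) (h' : MemLp (gradient w) 2 (volume.restrict U)) :
    SmoothApprox U w (gradient w) (fun _ => w) :=
  ⟨h, h', fun _ => hw, by simp, by simp⟩

lemma SmoothApprox.sub {w₁ w₂ : EuclideanSpace ℝ (Fin n) → ℝ}
    {W₁ W₂ : EuclideanSpace ℝ (Fin n) → EuclideanSpace ℝ (Fin n)}
    {wk₁ wk₂ : ℕ → EuclideanSpace ℝ (Fin n) → ℝ} (h₁ : SmoothApprox U w₁ W₁ wk₁)
    (h₂ : SmoothApprox U w₂ W₂ wk₂) :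
    SmoothApprox U (fun x => w₁ x - w₂ x) (fun x => W₁ x - W₂ x)
      (fun k x => wk₁ k x - wk₂ k x) := by
  refine ⟨h₁.memLp.sub h₂.memLp, h₁.memLp_grad.sub h₂.memLp_grad,
    fun k => (h₁.smooth k).sub (h₂.smooth k), ?_, ?_⟩
  · have hs := h₁.tendsto.add h₂.tendsto
    rw [add_zero] at hs
    refine tendsto_of_tendsto_of_tendsto_of_le_of_le tendsto_const_nhds hs
      (fun _ => zero_le) (fun k => ?_)
    refine le_trans (le_of_eq (congrArg (fun g => eLpNorm g 2 (volume.restrict U)) ?_))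
      (eLpNorm_sub_le (h₁.memLp.1.sub (h₁.smooth k).continuous.aestronglyMeasurable)
        (h₂.memLp.1.sub (h₂.smooth k).continuous.aestronglyMeasurable) (by norm_num))
    ext x
    simp only [Pi.sub_apply]
    ring
  · have hs := h₁.tendsto_grad.add h₂.tendsto_grad
    rw [add_zero] at hs
    refine tendsto_of_tendsto_of_tendsto_of_le_of_le tendsto_const_nhds hs
      (fun _ => zero_le) (fun k => ?_)
    refine le_trans (le_of_eq (congrArg (fun g => eLpNorm g 2 (volume.restrict U)) ?_))
      (eLpNorm_sub_le
        (h₁.memLp_grad.1.sub (continuous_gradient (h₁.smooth k)).aestronglyMeasurable)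
        (h₂.memLp_grad.1.sub (continuous_gradient (h₂.smooth k)).aestronglyMeasurable)
        (by norm_num))
    funext x
    simp only [Pi.sub_apply]
    rw [gradient_sub ((h₁.smooth k).differentiable (by simp)).differentiableAt
      ((h₂.smooth k).differentiable (by simp)).differentiableAt]
    abel

/-- Multiplication by a smooth function which is bounded together with its gradient. -/
lemma SmoothApprox.mul {w χ : EuclideanSpace ℝ (Fin n) → ℝ}
    {W : EuclideanSpace ℝ (Fin n) → EuclideanSpace ℝ (Fin n)}
    {wk : ℕ → EuclideanSpace ℝ (Fin n) → ℝ} (h : SmoothApprox U w W wk)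
    (hχ : ContDiff ℝ ∞ χ) {C C' : ℝ} (hC : ∀ x, |χ x| ≤ C) (hC' : ∀ x, ‖gradient χ x‖ ≤ C') :
    SmoothApprox U (fun x => χ x * w x) (fun x => χ x • W x + w x • gradient χ x)
      (fun k x => χ x * wk k x) := by
  have hχm : AEStronglyMeasurable χ (volume.restrict U) := hχ.continuous.aestronglyMeasurable
  have hχg : AEStronglyMeasurable (gradient χ) (volume.restrict U) :=
    (continuous_gradient hχ).aestronglyMeasurable
  have b1 : ∀ {r : EuclideanSpace ℝ (Fin n) → ℝ} x, ‖χ x * r x‖ ≤ C * ‖r x‖ := fun x => by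
    rw [norm_mul]; exact mul_le_mul_of_nonneg_right (hC x) (norm_nonneg _)
  have b2 : ∀ {r : EuclideanSpace ℝ (Fin n) → EuclideanSpace ℝ (Fin n)} x,
      ‖χ x • r x‖ ≤ C * ‖r x‖ := fun x => by
    rw [norm_smul]; exact mul_le_mul_of_nonneg_right (hC x) (norm_nonneg _)
  have b3 : ∀ {r : EuclideanSpace ℝ (Fin n) → ℝ} x, ‖r x • gradient χ x‖ ≤ C' * ‖r x‖ :=
    fun x => by
      rw [norm_smul, mul_comm]; exact mul_le_mul_of_nonneg_right (hC' x) (norm_nonneg _)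
  have z1 := ENNReal.Tendsto.const_mul (a := ENNReal.ofReal C) h.tendsto (Or.inr (by simp))
  have z2 := ENNReal.Tendsto.const_mul (a := ENNReal.ofReal C) h.tendsto_grad (Or.inr (by simp))
  have z3 := ENNReal.Tendsto.const_mul (a := ENNReal.ofReal C') h.tendsto (Or.inr (by simp))
  have z23 := z2.add z3
  simp only [mul_zero, add_zero] at z1 z23
  refine ⟨h.memLp.of_le_mul (hχm.mul h.memLp.1) (Eventually.of_forall fun x => b1 x),
    (h.memLp_grad.of_le_mul (hχm.smul h.memLp_grad.1) (Eventually.of_forall fun x => b2 x)).add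
      (h.memLp.of_le_mul (h.memLp.1.smul hχg) (Eventually.of_forall fun x => b3 x)),
    fun k => hχ.mul (h.smooth k), ?_, ?_⟩
  · refine tendsto_of_tendsto_of_tendsto_of_le_of_le tendsto_const_nhds z1
      (fun _ => zero_le) (fun k => ?_)
    refine eLpNorm_le_mul_eLpNorm_of_ae_le_mul (Eventually.of_forall fun x => ?_) 2
    rw [← mul_sub]
    exact b1 (r := fun x => w x - wk k x) x
  · refine tendsto_of_tendsto_of_tendsto_of_le_of_le tendsto_const_nhds z23
      (fun _ => zero_le) (fun k => ?_)
    have hm1 : AEStronglyMeasurable (fun x => w x - wk k x) (volume.restrict U) :=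
      h.memLp.1.sub (h.smooth k).continuous.aestronglyMeasurable
    have hm2 : AEStronglyMeasurable (fun x => W x - gradient (wk k) x) (volume.restrict U) :=
      h.memLp_grad.1.sub (continuous_gradient (h.smooth k)).aestronglyMeasurable
    refine le_trans (le_of_eq (congrArg (fun g => eLpNorm g 2 (volume.restrict U)) ?_))
      ((eLpNorm_add_le (hχm.smul hm2) (hm1.smul hχg) (by norm_num)).trans
        (add_le_add
          (eLpNorm_le_mul_eLpNorm_of_ae_le_mul
            (Eventually.of_forall fun x => b2 (r := fun x => W x - gradient (wk k) x) x) 2)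
          (eLpNorm_le_mul_eLpNorm_of_ae_le_mul
            (Eventually.of_forall fun x => b3 (r := fun x => w x - wk k x) x) 2)))
    funext x
    simp only [Pi.add_apply, Pi.smul_apply']
    rw [gradient_mul (hχ.differentiable (by simp)).differentiableAt
      ((h.smooth k).differentiable (by simp)).differentiableAt, smul_sub, sub_smul]
    abel

/-- The chain rule. The factor `θ' (wk k)` converges only almost everywhere, whence the passage to
a subsequence. -/
lemma SmoothApprox.comp {w : EuclideanSpace ℝ (Fin n) → ℝ}
    {W : EuclideanSpace ℝ (Fin n) → EuclideanSpace ℝ (Fin n)}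
    {wk : ℕ → EuclideanSpace ℝ (Fin n) → ℝ} (h : SmoothApprox U w W wk)
    {θ : ℝ → ℝ} (hθ : ContDiff ℝ ∞ θ) (hθ0 : θ 0 = 0) {C : ℝ} (hC : ∀ t, |deriv θ t| ≤ C) :
    ∃ ns : ℕ → ℕ, SmoothApprox U (fun x => θ (w x)) (fun x => deriv θ (w x) • W x)
      (fun k x => θ (wk (ns k) x)) := by
  have hd : Continuous (deriv θ) := hθ.continuous_deriv (by simp)
  have hdiff : Differentiable ℝ θ := hθ.differentiable (by simp)
  have hlip : ∀ s t, ‖θ s - θ t‖ ≤ C * ‖s - t‖ := fun s t =>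
    Convex.norm_image_sub_le_of_norm_deriv_le (fun x _ => hdiff x) (fun x _ => hC x)
      convex_univ (mem_univ _) (mem_univ _)
  have hm1 : ∀ k, AEStronglyMeasurable (wk k) (volume.restrict U) := fun k =>
    (h.smooth k).continuous.aestronglyMeasurable
  have hm2 : ∀ k, AEStronglyMeasurable (gradient (wk k)) (volume.restrict U) := fun k =>
    (continuous_gradient (h.smooth k)).aestronglyMeasurable
  have hmeas : TendstoInMeasure (volume.restrict U) wk atTop w := by
    refine tendstoInMeasure_of_tendsto_eLpNorm (p := 2) (by norm_num) hm1 h.memLp.1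
      (h.tendsto.congr fun k => ?_)
    rw [← eLpNorm_neg]
    congr 1
    ext x
    simp
  obtain ⟨ns, hns, hae⟩ := hmeas.exists_seq_tendsto_ae
  have s1 := h.tendsto.comp hns.tendsto_atTop
  have s2 := h.tendsto_grad.comp hns.tendsto_atTop
  have z1 := ENNReal.Tendsto.const_mul (a := ENNReal.ofReal C) s1 (Or.inr (by simp))
  have z2 := ENNReal.Tendsto.const_mul (a := ENNReal.ofReal C) s2 (Or.inr (by simp))
  have hdw : AEStronglyMeasurable (fun x => deriv θ (w x)) (volume.restrict U) :=
    hd.comp_aestronglyMeasurable h.memLp.1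
  have hdk : ∀ k, AEStronglyMeasurable (fun x => deriv θ (wk k x)) (volume.restrict U) :=
    fun k => hd.comp_aestronglyMeasurable (hm1 k)
  have z3 : Tendsto (fun k => eLpNorm (fun x => (deriv θ (w x) - deriv θ (wk (ns k) x)) • W x) 2
      (volume.restrict U)) atTop (𝓝 0) := by
    refine tendsto_eLpNorm_zero_of_dominated
      (fun k => (hdw.sub (hdk _)).smul h.memLp_grad.1) h.memLp_grad (C + C)
      (fun k => Eventually.of_forall fun x => ?_) ?_
    · rw [norm_smul]
      exact mul_le_mul_of_nonneg_right ((norm_sub_le _ _).trans (add_le_add (hC _) (hC _)))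
        (norm_nonneg _)
    · filter_upwards [hae] with x hx
      have := ((hd.tendsto _).comp hx).const_sub (deriv θ (w x))
      simpa using this.smul_const (W x)
  have z23 := z2.add z3
  simp only [mul_zero, add_zero] at z1 z23
  refine ⟨ns, ?_, ?_, fun k => hθ.comp (h.smooth _), ?_, ?_⟩
  · refine h.memLp.of_le_mul (c := C) (hθ.continuous.comp_aestronglyMeasurable h.memLp.1)
      (Eventually.of_forall fun x => ?_)
    simpa [hθ0] using hlip (w x) 0
  · refine h.memLp_grad.of_le_mul (c := C) (hdw.smul h.memLp_grad.1)
      (Eventually.of_forall fun x => ?_)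
    rw [norm_smul]
    exact mul_le_mul_of_nonneg_right (hC _) (norm_nonneg _)
  · exact tendsto_of_tendsto_of_tendsto_of_le_of_le tendsto_const_nhds z1 (fun _ => zero_le)
      (fun k => eLpNorm_le_mul_eLpNorm_of_ae_le_mul (Eventually.of_forall fun x => hlip _ _) 2)
  · refine tendsto_of_tendsto_of_tendsto_of_le_of_le tendsto_const_nhds z23
      (fun _ => zero_le) (fun k => ?_)
    refine le_trans (le_of_eq (congrArg (fun g => eLpNorm g 2 (volume.restrict U)) ?_))
      ((eLpNorm_add_le ((hdk (ns k)).smul (h.memLp_grad.1.sub (hm2 (ns k))))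
        ((hdw.sub (hdk (ns k))).smul h.memLp_grad.1) (by norm_num)).trans
        (add_le_add (eLpNorm_le_mul_eLpNorm_of_ae_le_mul (c := C)
          (Eventually.of_forall fun x => ?_) 2) le_rfl))
    · funext x
      simp only [Pi.add_apply, Pi.smul_apply', Pi.sub_apply]
      rw [gradient_comp (hdiff _)
        ((h.smooth (ns k)).differentiable (by simp)).differentiableAt, smul_sub, sub_smul]
      abel
    · simp only [Pi.smul_apply', Pi.sub_apply]
      rw [norm_smul]
      exact mul_le_mul_of_nonneg_right (hC _) (norm_nonneg _)

/-! ### A smooth substitute for the positive part -/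

lemma deriv_expNegInvGlue (t : ℝ) : deriv expNegInvGlue t = (t⁻¹) ^ 2 * expNegInvGlue t := by
  have h := expNegInvGlue.hasDerivAt_polynomial_eval_inv_mul 1 t
  simp only [Polynomial.eval_one, one_mul, Polynomial.derivative_one, sub_zero, mul_one,
    Polynomial.eval_pow, Polynomial.eval_X] at h
  exact h.deriv

lemma deriv_expNegInvGlue_nonneg (t : ℝ) : 0 ≤ deriv expNegInvGlue t := by
  rw [deriv_expNegInvGlue]
  exact mul_nonneg (sq_nonneg _) (expNegInvGlue.nonneg t)

lemma abs_deriv_expNegInvGlue_le (t : ℝ) : |deriv expNegInvGlue t| ≤ 2 := by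
  rw [abs_of_nonneg (deriv_expNegInvGlue_nonneg t), deriv_expNegInvGlue]
  rcases le_or_gt t 0 with ht | ht
  · rw [expNegInvGlue.zero_of_nonpos ht]; norm_num
  · have h1 : expNegInvGlue t = Real.exp (-t⁻¹) := by simp [expNegInvGlue, not_le.2 ht]
    have h2 := Real.quadratic_le_exp_of_nonneg (inv_nonneg.2 ht.le)
    rw [h1, Real.exp_neg, ← div_eq_mul_inv, div_le_iff₀ (Real.exp_pos _)]
    nlinarith [inv_pos.2 ht]

/-! ### Integration by parts in `H¹₀` -/

lemma memLp_restrict_of_continuous {F : Type*} [NormedAddCommGroup F]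
    [SecondCountableTopology F]
    {g : EuclideanSpace ℝ (Fin n) → F} (hg : Continuous g) (hU : Bornology.IsBounded U)
    (p : ℝ≥0∞) : MemLp g p (volume.restrict U) := by
  obtain ⟨C, hC⟩ := hU.isCompact_closure.exists_bound_of_continuousOn hg.continuousOn
  have h1 : MemLp g p (volume.restrict (closure U)) := by
    have : IsFiniteMeasure (volume.restrict (closure U)) :=
      ⟨by simpa using hU.isCompact_closure.measure_lt_top⟩
    refine MemLp.of_bound hg.aestronglyMeasurable C ?_
    filter_upwards [ae_restrict_mem isClosed_closure.measurableSet] with x hx using hC x hx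
  exact h1.mono_measure (Measure.restrict_mono_set _ subset_closure)

lemma IsH10With.integral_affine_mul_inner (hU : Bornology.IsBounded U)
    {w : EuclideanSpace ℝ (Fin n) → ℝ}
    {W : EuclideanSpace ℝ (Fin n) → EuclideanSpace ℝ (Fin n)} (h : IsH10With U w W)
    {ν : EuclideanSpace ℝ (Fin n)} (hν : ‖ν‖ = 1) (α β : ℝ) :
    ∫ x in U, (α + β * ⟪ν, x⟫) * ⟪ν, W x⟫ = - (β * ∫ x in U, w x) := by
  obtain ⟨φ, hφ, hap⟩ := h.exists_smoothApprox
  have ha : ContDiff ℝ ∞ fun x : EuclideanSpace ℝ (Fin n) => α + β * ⟪ν, x⟫ :=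
    contDiff_const.add (contDiff_const.mul (innerSL ℝ ν).contDiff)
  have hda : ∀ x : EuclideanSpace ℝ (Fin n), fderiv ℝ (fun x => α + β * ⟪ν, x⟫) x ν = β := by
    intro x
    have h1 : HasFDerivAt (fun x : EuclideanSpace ℝ (Fin n) => α + β * ⟪ν, x⟫)
        (β • innerSL ℝ ν) x :=
      (((innerSL ℝ ν).hasFDerivAt (x := x)).const_mul β).const_add α
    rw [h1.fderiv]
    simp [hν]
  have l1 : Tendsto (fun k => ∫ x in U, ⟪gradient (φ k) x, (α + β * ⟪ν, x⟫) • ν⟫) atTop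
      (𝓝 (∫ x in U, ⟪W x, (α + β * ⟪ν, x⟫) • ν⟫)) := tendsto_integral_bilin (innerSL ℝ) hap.memLp_grad
    (fun k => (continuous_gradient (hap.smooth k)).aestronglyMeasurable) hap.tendsto_grad
    (memLp_restrict_of_continuous (g := fun x => (α + β * ⟪ν, x⟫) • ν) (by fun_prop) hU 2)
  have l2 := tendsto_integral_bilin (ContinuousLinearMap.mul ℝ ℝ) hap.memLp
    (fun k => (hap.smooth k).continuous.aestronglyMeasurable) hap.tendsto
    (memLp_restrict_of_continuous (g := fun _ => β) continuous_const hU 2)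
  simp only [inner_smul_right, real_inner_comm ν] at l1
  simp only [ContinuousLinearMap.mul_apply'] at l2
  have e : ∫ x in U, w x * β = β * ∫ x in U, w x := by rw [integral_mul_const, mul_comm]
  rw [← e]
  refine tendsto_nhds_unique l1 (l2.neg.congr fun k => ?_)
  rw [(hφ k).integral_mul_inner_gradient ha ν]
  simp only [hda]
  simp only [mul_comm β]

/-- A nonnegative function of `H¹₀(U)` with vanishing gradient vanishes: integrating by parts
against `⟪ν, ·⟫` shows that its integral is zero. -/
lemma IsH10With.ae_eq_zero_of_grad_ae_eq_zero (hU : Bornology.IsBounded U)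
    {w : EuclideanSpace ℝ (Fin n) → ℝ}
    {W : EuclideanSpace ℝ (Fin n) → EuclideanSpace ℝ (Fin n)} (h : IsH10With U w W)
    {ν : EuclideanSpace ℝ (Fin n)} (hν : ‖ν‖ = 1)
    (hw : ∀ᵐ x ∂(volume.restrict U), 0 ≤ w x) (hW : ∀ᵐ x ∂(volume.restrict U), W x = 0) :
    ∀ᵐ x ∂(volume.restrict U), w x = 0 := by
  have h1 := h.integral_affine_mul_inner hU hν 0 1
  have h2 : ∫ x in U, (0 + 1 * ⟪ν, x⟫) * ⟪ν, W x⟫ = 0 := by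
    rw [integral_eq_zero_of_ae]
    filter_upwards [hW] with x hx
    simp [hx]
  have : IsFiniteMeasure (volume.restrict U) := ⟨by simpa using hU.measure_lt_top⟩
  have h3 : ∫ x in U, w x = 0 := by linarith
  have h4 := (integral_eq_zero_iff_of_nonneg_ae hw (h.memLp.integrable (by norm_num))).1 h3
  filter_upwards [h4] with x hx using hx

lemma integrable_inner_of_memLp {W W' : EuclideanSpace ℝ (Fin n) → EuclideanSpace ℝ (Fin n)}
    {μ : Measure (EuclideanSpace ℝ (Fin n))} (h : MemLp W 2 μ) (h' : MemLp W' 2 μ) :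
    Integrable (fun x => ⟪W x, W' x⟫) μ :=
  memLp_one_iff_integrable.1 (h.of_bilin (fun x y => ⟪x, y⟫) 1 h' (h.1.inner h'.1)
    (Eventually.of_forall fun x => by simpa using nnnorm_inner_le_nnnorm (𝕜 := ℝ) _ _))

/-- The energy argument behind the weak maximum principle, with `θ = expNegInvGlue` in the place of
the positive part. -/
lemma ae_nonpos_of_integral_inner_nonpos (hU : Bornology.IsBounded U)
    {w : EuclideanSpace ℝ (Fin n) → ℝ}
    {W : EuclideanSpace ℝ (Fin n) → EuclideanSpace ℝ (Fin n)}
    {ν : EuclideanSpace ℝ (Fin n)} (hν : ‖ν‖ = 1) (hW : MemLp W 2 (volume.restrict U))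
    (h : IsH10With U (fun x => expNegInvGlue (w x))
      (fun x => deriv expNegInvGlue (w x) • W x))
    (hle : ∫ x in U, ⟪W x, deriv expNegInvGlue (w x) • W x⟫ ≤ 0) :
    ∀ᵐ x ∂(volume.restrict U), w x ≤ 0 := by
  have hnn : ∀ x, 0 ≤ ⟪W x, deriv expNegInvGlue (w x) • W x⟫ := fun x => by
    rw [inner_smul_right]
    exact mul_nonneg (deriv_expNegInvGlue_nonneg _) real_inner_self_nonneg
  have h0 := (integral_eq_zero_iff_of_nonneg hnn (integrable_inner_of_memLp hW h.memLp_grad)).1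
    (le_antisymm hle (integral_nonneg hnn))
  have h1 := h.ae_eq_zero_of_grad_ae_eq_zero hU hν
    (Eventually.of_forall fun x => expNegInvGlue.nonneg _) (by
      filter_upwards [h0] with x hx
      simp only [Pi.zero_apply, inner_smul_right, mul_eq_zero, inner_self_eq_zero] at hx
      exact smul_eq_zero.2 hx)
  filter_upwards [h1] with x hx
  exact expNegInvGlue.zero_iff_nonpos.1 hx

/-! ### The barrier -/

/-- If `b ≥ 0` on `U`, then `θ (φ - b)`, cut off to zero outside `U`, is a test function on `U`:
it vanishes off the support of `φ`. -/
lemma IsTestFunction.indicator_expNegInvGlue (hU : IsOpen U)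
    {φ b : EuclideanSpace ℝ (Fin n) → ℝ} (hφ : IsTestFunction U φ) (hb : ContDiff ℝ ∞ b)
    (hb0 : ∀ x ∈ U, 0 ≤ b x) :
    IsTestFunction U (U.indicator fun x => expNegInvGlue (φ x - b x)) := by
  have hz : ∀ x, φ x = 0 → U.indicator (fun x => expNegInvGlue (φ x - b x)) x = 0 := fun x hx => by
    by_cases hxU : x ∈ U
    · rw [indicator_of_mem hxU, hx]
      exact expNegInvGlue.zero_of_nonpos (by simpa using hb0 x hxU)
    · exact indicator_of_notMem hxU _
  have hts : tsupport (U.indicator fun x => expNegInvGlue (φ x - b x)) ⊆ tsupport φ :=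
    closure_mono fun x hx h => hx (hz x h)
  refine ⟨contDiff_iff_contDiffAt.2 fun x => ?_,
    hφ.compact_support.mono' ((subset_tsupport _).trans hts), hts.trans hφ.support_subset⟩
  by_cases hx : x ∈ tsupport φ
  · have hd : ContDiff ℝ ∞ fun x => expNegInvGlue (φ x - b x) :=
      (expNegInvGlue.contDiff (n := ⊤)).comp (hφ.smooth.sub hb)
    refine hd.contDiffAt.congr_of_eventuallyEq ?_
    filter_upwards [hU.mem_nhds (hφ.support_subset hx)] with y hy
    exact indicator_of_mem hy _
  · refine (contDiffAt_const (c := (0 : ℝ))).congr_of_eventuallyEq ?_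
    filter_upwards [notMem_tsupport_iff_eventuallyEq.1 hx] with y hy
    exact hz y hy

/-- The barrier estimate: on a set contained in the strip `0 ≤ m - ⟪ν, x⟫ ≤ D`, the function
`C / 2 * s * (D - s)`, `s = m - ⟪ν, x⟫`, is a supersolution, and so it bounds the solution. -/
lemma IsWeakSolution.ae_le_barrier (hU : IsOpen U) (hUb : Bornology.IsBounded U)
    {f u : EuclideanSpace ℝ (Fin n) → ℝ} (hf : MemLp f ∞ (volume.restrict U))
    (hu : IsWeakSolution U f u) {ν : EuclideanSpace ℝ (Fin n)} (hν : ‖ν‖ = 1) {C m D : ℝ}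
    (hC : 0 ≤ C) (hfC : ∀ᵐ x ∂(volume.restrict U), f x ≤ C)
    (hlo : ∀ x ∈ U, ⟪ν, x⟫ ≤ m) (hhi : ∀ x ∈ U, m - ⟪ν, x⟫ ≤ D) :
    ∀ᵐ x ∂(volume.restrict U), u x ≤ C / 2 * D * (m - ⟪ν, x⟫) := by
  obtain ⟨G, hG, heq⟩ := hu
  obtain ⟨φ, hφ, hap⟩ := hG.exists_smoothApprox
  set q : ℝ → ℝ := fun t => C / 2 * ((m - t) * (D - (m - t))) with hq
  set b : EuclideanSpace ℝ (Fin n) → ℝ := fun x => q ⟪ν, x⟫ with hb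
  have hqs : ContDiff ℝ ∞ q := by fun_prop
  have hbs : ContDiff ℝ ∞ b := hqs.comp (innerSL ℝ ν).contDiff
  have hb0 : ∀ x ∈ U, 0 ≤ b x := fun x hx =>
    mul_nonneg (by linarith) (mul_nonneg (by linarith [hlo x hx]) (by linarith [hhi x hx]))
  have hbg : ∀ x, gradient b x = (C / 2 * (2 * m - D) + -C * ⟪ν, x⟫) • ν := by
    intro x
    have h1 : HasDerivAt q (C / 2 * (2 * m - D) + -C * ⟪ν, x⟫) ⟪ν, x⟫ := by
      have h2 := ((hasDerivAt_id ⟪ν, x⟫).const_sub m)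
      have h3 := (h2.mul (h2.const_sub D)).const_mul (C / 2)
      refine h3.congr_deriv ?_
      simp only [id]
      ring
    have h4 : gradient (fun y => ⟪ν, y⟫) x = ν := by
      refine ext_inner_right ℝ fun v => ?_
      rw [inner_gradient_left]
      rw [show (fun y => ⟪ν, y⟫) = innerSL ℝ ν by ext; simp, ContinuousLinearMap.fderiv]
      simp
    rw [hb, gradient_comp h1.differentiableAt (innerSL ℝ ν).differentiableAt, h1.deriv, h4]
  have hcomp := hap.sub (SmoothApprox.const hbs (memLp_restrict_of_continuous hbs.continuous hUb 2)
    (memLp_restrict_of_continuous (continuous_gradient hbs) hUb 2))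
  obtain ⟨ns, hap'⟩ := hcomp.comp (expNegInvGlue.contDiff (n := ⊤)) expNegInvGlue.zero
    abs_deriv_expNegInvGlue_le
  have hH := hap'.isH10With hU (fun k => (hφ (ns k)).indicator_expNegInvGlue hU hbs hb0)
    (fun k x hx => indicator_of_mem hx _)
  have e1 := heq _ _ hH
  have e2 := hH.integral_affine_mul_inner hUb hν (C / 2 * (2 * m - D)) (-C)
  have : IsFiniteMeasure (volume.restrict U) := ⟨by simpa using hUb.measure_lt_top⟩
  have hhI : Integrable (fun x => expNegInvGlue (u x - b x)) (volume.restrict U) :=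
    hH.memLp.integrable (by norm_num)
  have hfh : Integrable (fun x => f x * expNegInvGlue (u x - b x)) (volume.restrict U) :=
    hhI.essSup_smul hf.1 (by simpa only [eLpNorm_exponent_top, eLpNormEssSup] using hf.2.ne)
  have hle : ∫ x in U, ⟪G x - gradient b x, deriv expNegInvGlue (u x - b x) •
      (G x - gradient b x)⟫ ≤ 0 := by
    simp only [inner_sub_left, hbg,
      inner_smul_left _ _ (C / 2 * (2 * m - D) + -C * ⟪ν, _⟫)] at e1 e2 ⊢
    rw [integral_sub]
    · simp only [RCLike.conj_to_real]
      rw [e1, e2, ← sub_nonneg]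
      have : ∫ x in U, f x * expNegInvGlue (u x - b x) ≤
          ∫ x in U, C * expNegInvGlue (u x - b x) := by
        refine integral_mono_ae hfh (hhI.const_mul C) ?_
        filter_upwards [hfC] with x hx
        exact mul_le_mul_of_nonneg_right hx (expNegInvGlue.nonneg _)
      rw [integral_const_mul] at this
      linarith
    · have := integrable_inner_of_memLp hap.memLp_grad hH.memLp_grad
      simpa only [hbg] using this
    · have := integrable_inner_of_memLp
        (memLp_restrict_of_continuous (continuous_gradient hbs) hUb 2) hH.memLp_grad
      simpa only [hbg, inner_smul_left] using this
  have hfin := ae_nonpos_of_integral_inner_nonpos hUb hν hcomp.memLp_grad hH hle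
  filter_upwards [hfin, ae_restrict_mem hU.measurableSet] with x hx hxU
  have h1 : u x ≤ C / 2 * ((m - ⟪ν, x⟫) * (D - (m - ⟪ν, x⟫))) := sub_nonpos.1 hx
  nlinarith [mul_nonneg hC (sq_nonneg (m - ⟪ν, x⟫))]

/-! ### Comparison of two solutions -/

lemma SmoothApprox.congr {w w' : EuclideanSpace ℝ (Fin n) → ℝ}
    {W W' : EuclideanSpace ℝ (Fin n) → EuclideanSpace ℝ (Fin n)}
    {wk : ℕ → EuclideanSpace ℝ (Fin n) → ℝ} (h : SmoothApprox U w W wk)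
    (hw : w =ᵐ[volume.restrict U] w') (hW : W =ᵐ[volume.restrict U] W') :
    SmoothApprox U w' W' wk := by
  refine ⟨(memLp_congr_ae hw).1 h.memLp, (memLp_congr_ae hW).1 h.memLp_grad, h.smooth,
    h.tendsto.congr fun k => eLpNorm_congr_ae ?_, h.tendsto_grad.congr fun k =>
      eLpNorm_congr_ae ?_⟩
  · filter_upwards [hw] with x hx
    rw [hx]
  · filter_upwards [hW] with x hx
    rw [hx]

/-- Extension by zero maps `H¹₀(V)` to `H¹₀(U)` for `V ⊆ U`. -/
lemma IsH10With.indicator (hU : IsOpen U) (hV : IsOpen V) (hVU : V ⊆ U)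
    {w : EuclideanSpace ℝ (Fin n) → ℝ}
    {W : EuclideanSpace ℝ (Fin n) → EuclideanSpace ℝ (Fin n)} (h : IsH10With V w W) :
    IsH10With U (V.indicator w) (V.indicator W) := by
  obtain ⟨φ, hφ, hap⟩ := h.exists_smoothApprox
  have hr : (volume.restrict U).restrict V =
      (volume : Measure (EuclideanSpace ℝ (Fin n))).restrict V := by
    rw [Measure.restrict_restrict hV.measurableSet, inter_eq_left.2 hVU]
  refine SmoothApprox.isH10With (wk := φ) (ψ := φ) hU ⟨?_, ?_, hap.smooth, ?_, ?_⟩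
    (fun k => (hφ k).mono hVU) (fun _ _ _ => rfl)
  · rw [memLp_indicator_iff_restrict hV.measurableSet, hr]
    exact h.memLp
  · rw [memLp_indicator_iff_restrict hV.measurableSet, hr]
    exact h.memLp_grad
  · refine hap.tendsto.congr fun k => ?_
    rw [← hr, ← eLpNorm_indicator_eq_eLpNorm_restrict hV.measurableSet]
    congr 1
    ext x
    by_cases hx : x ∈ V
    · simp [hx]
    · simp [hx, (hφ k).eq_zero hx]
  · refine hap.tendsto_grad.congr fun k => ?_
    rw [← hr, ← eLpNorm_indicator_eq_eLpNorm_restrict hV.measurableSet]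
    congr 1
    ext1 x
    by_cases hx : x ∈ V
    · simp [hx]
    · simp [hx, (hφ k).gradient_eq_zero hx]

lemma exists_testFunction_eq_one (hV : IsOpen V) {K : Set (EuclideanSpace ℝ (Fin n))}
    (hK : IsCompact K) (hKV : K ⊆ V) :
    ∃ χ : EuclideanSpace ℝ (Fin n) → ℝ, IsTestFunction V χ ∧ (∀ᶠ x in 𝓝ˢ K, χ x = 1) ∧
      ∀ x, |χ x| ≤ 1 := by
  obtain ⟨L, hL, hKL, hLV⟩ := exists_compact_between hK hV hKV
  obtain ⟨χ, h1, h0, hI⟩ := exists_contMDiffMap_one_nhds_of_subset_interior (n := ⊤)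
    (modelWithCornersSelf ℝ (EuclideanSpace ℝ (Fin n))) hK.isClosed hKL
  refine ⟨χ, ⟨χ.contMDiff.contDiff, HasCompactSupport.intro hL h0, ?_⟩, h1, fun x => ?_⟩
  · exact (closure_minimal (Function.support_subset_iff'.2 h0) hL.isClosed).trans hLV
  · rw [abs_of_nonneg (hI x).1]
    exact (hI x).2

/-- Weak maximum principle for the difference of two solutions on nested sets: if `u ≤ v + c`
outside a compact subset of the smaller set `V`, then `u ≤ v + c` in `V`. -/
lemma IsWeakSolution.ae_le_add_of_ae_le_add_off_compact (hU : IsOpen U)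
    (hUb : Bornology.IsBounded U) (hV : IsOpen V) (hVU : V ⊆ U)
    {f u v : EuclideanSpace ℝ (Fin n) → ℝ} (hu : IsWeakSolution U f u)
    (hv : IsWeakSolution V f v) {ν : EuclideanSpace ℝ (Fin n)} (hν : ‖ν‖ = 1)
    {K : Set (EuclideanSpace ℝ (Fin n))} (hK : IsCompact K) (hKV : K ⊆ V) {c : ℝ}
    (hle : ∀ᵐ x ∂(volume.restrict V), x ∉ K → u x ≤ v x + c) :
    ∀ᵐ x ∂(volume.restrict V), u x ≤ v x + c := by
  obtain ⟨G, hG, heqG⟩ := hu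
  obtain ⟨J, hJ, heqJ⟩ := hv
  obtain ⟨φ, -, hapu⟩ := hG.exists_smoothApprox
  obtain ⟨ψ, -, hapv⟩ := hJ.exists_smoothApprox
  obtain ⟨χ, hχ, hχ1, hχb⟩ := exists_testFunction_eq_one hV hK hKV
  have hVb := hUb.subset hVU
  obtain ⟨C', hC'⟩ := (hasCompactSupport_gradient hχ.compact_support).exists_bound_of_continuous
    (continuous_gradient hχ.smooth)
  have hc : SmoothApprox V (fun _ => c) (gradient fun _ => c) (fun _ _ => c) :=
    SmoothApprox.const contDiff_const (memLp_restrict_of_continuous continuous_const hVb 2)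
      (memLp_restrict_of_continuous (continuous_gradient contDiff_const) hVb 2)
  have hw : SmoothApprox V (fun x => u x - v x - c) (fun x => G x - J x) _ :=
    (((hapu.mono hVU).sub hapv).sub hc).congr (Eventually.of_forall fun _ => rfl)
      (Eventually.of_forall fun x => by simp [gradient_fun_const])
  obtain ⟨ns, hap⟩ := hw.comp (expNegInvGlue.contDiff (n := ⊤)) expNegInvGlue.zero
    abs_deriv_expNegInvGlue_le
  have hcut : SmoothApprox V (fun x => expNegInvGlue (u x - v x - c))
      (fun x => deriv expNegInvGlue (u x - v x - c) • (G x - J x))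
      (fun k x => χ x * expNegInvGlue (φ (ns k) x - ψ (ns k) x - c)) := by
    -- Off `K` the truncation and its derivative vanish, so the cutoff `χ` changes nothing.
    have hcases : ∀ᵐ x ∂(volume.restrict V), (χ x = 1 ∧ gradient χ x = 0) ∨
        (expNegInvGlue (u x - v x - c) = 0 ∧ deriv expNegInvGlue (u x - v x - c) = 0) := by
      filter_upwards [hle] with x hx
      by_cases hxK : x ∈ K
      · left
        have h1 : χ =ᶠ[𝓝 x] fun _ => (1 : ℝ) := hχ1.filter_mono (nhds_le_nhdsSet hxK)
        exact ⟨h1.eq_of_nhds, by rw [h1.gradient_eq, gradient_fun_const]⟩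
      · right
        have h2 := expNegInvGlue.zero_of_nonpos (x := u x - v x - c) (by linarith [hx hxK])
        exact ⟨h2, by rw [deriv_expNegInvGlue, h2, mul_zero]⟩
    refine (hap.mul hχ.smooth hχb hC').congr ?_ ?_
    · filter_upwards [hcases] with x hx
      rcases hx with hx | hx <;> simp [hx.1]
    · filter_upwards [hcases] with x hx
      rcases hx with hx | hx <;> simp [hx.1, hx.2]
  have hH := hcut.isH10With hV (fun k => ⟨hχ.smooth.mul (hap.smooth k),
    hχ.compact_support.mul_right, (tsupport_mul_subset_left).trans hχ.support_subset⟩)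
    (fun k x _ => rfl)
  have e1 := heqJ _ _ hH
  have e2 := heqG _ _ (hH.indicator hU hV hVU)
  have i1 : ∀ x, ⟪G x, V.indicator
      (fun x => deriv expNegInvGlue (u x - v x - c) • (G x - J x)) x⟫ =
      V.indicator (fun x => ⟪G x, deriv expNegInvGlue (u x - v x - c) • (G x - J x)⟫) x :=
    fun x => by by_cases hx : x ∈ V <;> simp [hx]
  have i2 : ∀ x, f x * V.indicator (fun x => expNegInvGlue (u x - v x - c)) x =
      V.indicator (fun x => f x * expNegInvGlue (u x - v x - c)) x :=
    fun x => by by_cases hx : x ∈ V <;> simp [hx]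
  simp only [i1, i2] at e2
  rw [setIntegral_indicator hV.measurableSet, setIntegral_indicator hV.measurableSet,
    inter_eq_right.2 hVU] at e2
  have hz : ∫ x in V, ⟪G x - J x, deriv expNegInvGlue (u x - v x - c) • (G x - J x)⟫ ≤ 0 := by
    have h1 : ∀ x, ⟪G x - J x, deriv expNegInvGlue (u x - v x - c) • (G x - J x)⟫ =
        ⟪G x, deriv expNegInvGlue (u x - v x - c) • (G x - J x)⟫ -
        ⟪J x, deriv expNegInvGlue (u x - v x - c) • (G x - J x)⟫ := fun x => inner_sub_left _ _ _
    simp only [h1]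
    rw [integral_sub
      (integrable_inner_of_memLp (hapu.mono hVU).memLp_grad hH.memLp_grad)
      (integrable_inner_of_memLp hapv.memLp_grad hH.memLp_grad), e1, e2, sub_self]
  filter_upwards [ae_nonpos_of_integral_inner_nonpos hVb hν hw.memLp_grad hH hz] with x hx
  linarith

lemma IsWeakSolution.neg {f u : EuclideanSpace ℝ (Fin n) → ℝ}
    (hu : IsWeakSolution U f u) : IsWeakSolution U (fun x => -f x) (fun x => -u x) := by
  obtain ⟨G, hG, heq⟩ := hu
  have hgn : ∀ (φ : EuclideanSpace ℝ (Fin n) → ℝ) x,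
      gradient (fun x => -φ x) x = -gradient φ x := fun φ x => by
    simp only [gradient]
    rw [show (fun x => -φ x) = -φ from rfl, fderiv_neg, map_neg]
  refine ⟨fun x => -G x, ⟨⟨hG.memLp.neg, hG.memLp_grad.neg, fun φ hφ => ?_⟩, fun ε hε => ?_⟩,
    fun w H hH => ?_⟩
  · have := hG.weak_gradient φ hφ
    simp only [neg_smul, smul_neg, integral_neg, this]
  · obtain ⟨φ, hφ, h1, h2⟩ := hG.approx ε hε
    refine ⟨fun x => -φ x, hφ.neg, ?_, ?_⟩
    · rw [← eLpNorm_neg]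
      convert h1 using 2
      ext x
      simp only [Pi.neg_apply]
      ring
    · rw [← eLpNorm_neg]
      convert h2 using 2
      funext x
      simp only [Pi.neg_apply, hgn]
      abel
  · have := heq w H hH
    simp only [inner_neg_left, neg_mul, integral_neg, this]

end Sobolev

section Geometry

variable {n : ℕ} {Ω P F : Set (EuclideanSpace ℝ (Fin n))} {ν : EuclideanSpace ℝ (Fin n)}

/-! ### Barycenters of facets -/

/-- The Hausdorff measure of its own dimension is positive and finite on a compact convex set: in
the direction space of the set it is an additive Haar measure. -/
lemma hausdorffMeasure_vectorSpan_ne_zero_ne_top (hF : Convex ℝ F) (hFc : IsCompact F)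
    (hFn : F.Nonempty) :
    μH[(Module.finrank ℝ (vectorSpan ℝ F) : ℝ)] F ≠ 0 ∧
      μH[(Module.finrank ℝ (vectorSpan ℝ F) : ℝ)] F ≠ ⊤ := by
  obtain ⟨y, hy⟩ := hFn
  set T : vectorSpan ℝ F → EuclideanSpace ℝ (Fin n) := fun v => y + (v : EuclideanSpace ℝ (Fin n))
    with hT
  have hTi : Isometry T := (isometry_add_left y).comp isometry_subtype_coe
  set S : Set (vectorSpan ℝ F) := T ⁻¹' F with hS
  have hTS : T '' S = F := by
    refine Subset.antisymm (image_preimage_subset _ _) fun x hx => ?_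
    exact ⟨⟨x - y, vsub_mem_vectorSpan ℝ hx hy⟩, by simpa [hS, hT] using hx, by simp [hT]⟩
  have hSc : IsCompact S := by
    rw [hTi.isEmbedding.isInducing.isCompact_iff, hTS]
    exact hFc
  have hSconv : Convex ℝ S :=
    (hF.translate_preimage_right y).linear_preimage (vectorSpan ℝ F).subtype
  have h0 : (0 : vectorSpan ℝ F) ∈ S := by simpa [hS, hT] using hy
  have hspan : Submodule.span ℝ S = ⊤ := by
    refine Submodule.map_injective_of_injective (vectorSpan ℝ F).subtype_injective ?_
    rw [← Submodule.span_image, Submodule.map_subtype_top]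
    conv_rhs => rw [vectorSpan_eq_span_vsub_set_right ℝ hy]
    congr 1
    have h1 : (fun x => x -ᵥ y) '' (T '' S) = (vectorSpan ℝ F).subtype '' S := by
      rw [image_image]
      simp [hT]
    rw [← h1, hTS]
  have hint : (interior S).Nonempty := by
    rw [hSconv.interior_nonempty_iff_affineSpan_eq_top,
      AffineSubspace.affineSpan_eq_top_iff_vectorSpan_eq_top_of_nonempty ℝ _ _ ⟨0, h0⟩,
      vectorSpan_eq_span_vsub_set_right ℝ h0]
    simpa using hspan
  have hH : μH[(Module.finrank ℝ (vectorSpan ℝ F) : ℝ)] F =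
      μH[(Module.finrank ℝ (vectorSpan ℝ F) : ℝ)] S := by
    have h1 := hTi.hausdorffMeasure_image
      (Or.inl (Nat.cast_nonneg (Module.finrank ℝ (vectorSpan ℝ F)))) S
    rwa [hTS] at h1
  rw [hH]
  exact ⟨fun h => (isOpen_interior.measure_pos _ hint).ne'
    (measure_mono_null interior_subset h), hSc.measure_lt_top.ne⟩

/-- The Hausdorff measure of a facet is positive and finite, so its barycenter is a genuine mean and
lies in the facet by convexity. -/
lemma IsFacet.barycenter_mem (hPc : Convex ℝ P) (hPb : Bornology.IsBounded P)
    (h : IsFacet P F ν) : barycenter F ∈ F := by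
  have hFconv : Convex ℝ F := by
    rw [h.eq_face]
    intro x hx y hy a b ha hb hab
    refine ⟨hPc.closure hx.1 hy.1 ha hb hab, fun z hz => ?_⟩
    rw [inner_add_right, inner_smul_right, inner_smul_right]
    calc ⟪ν, z⟫ = a * ⟪ν, z⟫ + b * ⟪ν, z⟫ := by rw [← add_mul, hab, one_mul]
      _ ≤ _ := add_le_add (mul_le_mul_of_nonneg_left (hx.2 z hz) ha)
          (mul_le_mul_of_nonneg_left (hy.2 z hz) hb)
  have hFclosed : IsClosed F := by
    rw [h.eq_face]
    have h1 : {x | x ∈ closure P ∧ ∀ y ∈ closure P, ⟪ν, y⟫ ≤ ⟪ν, x⟫} =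
        closure P ∩ ⋂ y ∈ closure P, {x | ⟪ν, y⟫ ≤ ⟪ν, x⟫} := by ext; simp
    rw [h1]
    exact isClosed_closure.inter (isClosed_biInter fun y _ =>
      isClosed_le continuous_const (by fun_prop))
  have hFc : IsCompact F := hPb.isCompact_closure.of_isClosed_subset hFclosed
    (by rw [h.eq_face]; exact fun x hx => hx.1)
  have hdim : (n : ℝ) - 1 = (Module.finrank ℝ (vectorSpan ℝ F) : ℝ) := by
    have h1 : ((Module.finrank ℝ (vectorSpan ℝ F) + 1 : ℕ) : ℝ) = n := congrArg _ h.dim_eq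
    push_cast at h1
    linarith
  obtain ⟨hz, ht⟩ := hausdorffMeasure_vectorSpan_ne_zero_ne_top hFconv hFc h.nonempty
  unfold barycenter
  rw [hdim]
  refine hFconv.set_average_mem hFclosed hz ht (ae_restrict_mem hFclosed.measurableSet) ?_
  obtain ⟨C, hC⟩ := hFc.isBounded.exists_norm_le
  refine IntegrableOn.of_bound ht.lt_top measurable_id.aestronglyMeasurable C ?_
  filter_upwards [ae_restrict_mem hFclosed.measurableSet] with x hx using hC x hx

/-- The set whose supremum is the gap is bounded above, by the diameter of `Ω`, so the `sSup` in
`gap` is a genuine supremum. -/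
lemma IsFacet.le_gap (hΩ : Bornology.IsBounded Ω) (hPc : Convex ℝ P) (hP : P ⊆ closure Ω)
    (h : IsFacet P F ν) {x : EuclideanSpace ℝ (Fin n)} (hx : x ∈ frontier Ω) :
    ⟪ν, x - barycenter F⟫ ≤ gap Ω P := by
  refine le_csSup ⟨Metric.diam (closure Ω), ?_⟩ ⟨F, ν, h, x, hx, rfl⟩
  rintro t ⟨F', ν', h', x', hx', rfl⟩
  have hb := h'.eq_face.subset (h'.barycenter_mem hPc (hΩ.closure.subset hP))
  calc ⟪ν', x' - barycenter F'⟫ ≤ ‖ν'‖ * ‖x' - barycenter F'‖ := real_inner_le_norm _ _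
    _ = dist x' (barycenter F') := by rw [h'.norm_normal, one_mul, dist_eq_norm]
    _ ≤ _ := Metric.dist_le_diam_of_mem hΩ.closure (frontier_subset_closure hx')
      (closure_minimal hP isClosed_closure hb.1)

/-! ### A polyhedron is the intersection of the half-spaces of its facets -/

/-- The intersection of the open half-spaces `⟪h.1, x⟫ < h.2`, for `h ∈ s`. -/
def halfSpaces (s : Finset (EuclideanSpace ℝ (Fin n) × ℝ)) : Set (EuclideanSpace ℝ (Fin n)) :=
  {x | ∀ h ∈ s, ⟪h.1, x⟫ < h.2}

lemma isOpen_halfSpaces (s : Finset (EuclideanSpace ℝ (Fin n) × ℝ)) : IsOpen (halfSpaces s) := by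
  have : halfSpaces s = ⋂ h ∈ s, {x | ⟪h.1, x⟫ < h.2} := by ext; simp [halfSpaces]
  rw [this]
  exact isOpen_biInter_finset fun h _ => isOpen_lt (by fun_prop) continuous_const

lemma convex_halfSpaces (s : Finset (EuclideanSpace ℝ (Fin n) × ℝ)) :
    Convex ℝ (halfSpaces s) := by
  have : halfSpaces s = ⋂ h ∈ s, {x | ⟪h.1, x⟫ < h.2} := by ext; simp [halfSpaces]
  rw [this]
  exact convex_iInter₂ fun h _ => convex_halfSpace_lt (innerSL ℝ h.1).isLinear h.2

open Classical in
/-- Discarding redundant constraints one by one leaves an irredundant system. -/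
lemma exists_irredundant_halfSpaces (s : Finset (EuclideanSpace ℝ (Fin n) × ℝ)) :
    ∃ t ⊆ s, halfSpaces t = halfSpaces s ∧
      ∀ h ∈ t, halfSpaces (t.erase h) ≠ halfSpaces t := by
  induction s using Finset.strongInduction with
  | H s ih =>
    by_cases hs : ∃ h ∈ s, halfSpaces (s.erase h) = halfSpaces s
    · obtain ⟨h, hh, he⟩ := hs
      obtain ⟨t, hts, ht, hmin⟩ := ih _ (Finset.erase_ssubset hh)
      exact ⟨t, hts.trans (Finset.erase_subset _ _), ht.trans he, hmin⟩
    · push Not at hs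
      exact ⟨s, Finset.Subset.refl _, rfl, hs⟩

open Classical in
/-- An irredundant half-space cuts out a facet: on the segment from a point of the polyhedron to a
point which violates this constraint only, there is a point of the bounding hyperplane at which
all other constraints are strict, and a neighbourhood of it in the hyperplane lies in the face. -/
lemma exists_isFacet_of_irredundant {t : Finset (EuclideanSpace ℝ (Fin n) × ℝ)}
    (hne : (halfSpaces t).Nonempty) {h : EuclideanSpace ℝ (Fin n) × ℝ} (ht : h ∈ t)
    (hnorm : ‖h.1‖ = 1) (hirr : halfSpaces (t.erase h) ≠ halfSpaces t) :
    ∃ F, IsFacet (halfSpaces t) F h.1 ∧ ∀ y ∈ F, ⟪h.1, y⟫ = h.2 := by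
  have hsub : halfSpaces t ⊆ halfSpaces (t.erase h) := fun x hx g hg =>
    hx g (Finset.mem_of_mem_erase hg)
  have hmem : ∀ x, x ∈ halfSpaces (t.erase h) → ⟪h.1, x⟫ < h.2 → x ∈ halfSpaces t := by
    intro x hx hlt g hg
    by_cases hgh : g = h
    · rw [hgh]; exact hlt
    · exact hx g (Finset.mem_erase.2 ⟨hgh, hg⟩)
  obtain ⟨p, hp⟩ := hne
  obtain ⟨y, hy, hyP⟩ : ∃ y ∈ halfSpaces (t.erase h), y ∉ halfSpaces t := by
    by_contra! hcon
    exact hirr (Subset.antisymm hcon hsub)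
  have hy2 : h.2 ≤ ⟪h.1, y⟫ := not_lt.1 fun hlt => hyP (hmem y hy hlt)
  have hp2 : ⟪h.1, p⟫ < h.2 := hp h ht
  have hden : 0 < ⟪h.1, y⟫ - ⟪h.1, p⟫ := by linarith
  set l : ℝ := (h.2 - ⟪h.1, p⟫) / (⟪h.1, y⟫ - ⟪h.1, p⟫) with hl
  have hl0 : 0 ≤ l := div_nonneg (by linarith) hden.le
  have hl1 : l ≤ 1 := (div_le_one hden).2 (by linarith)
  set z := (1 - l) • p + l • y with hz
  have hzE : z ∈ halfSpaces (t.erase h) :=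
    convex_halfSpaces _ (hsub hp) hy (by linarith) hl0 (by ring)
  have hz2 : ⟪h.1, z⟫ = h.2 := by
    have : l * (⟪h.1, y⟫ - ⟪h.1, p⟫) = h.2 - ⟪h.1, p⟫ := div_mul_cancel₀ _ hden.ne'
    rw [hz, inner_add_right, inner_smul_right, inner_smul_right]
    linarith
  have hle : ∀ x ∈ closure (halfSpaces t), ⟪h.1, x⟫ ≤ h.2 := fun x hx =>
    closure_minimal (t := {x | ⟪h.1, x⟫ ≤ h.2}) (fun x hx => (hx h ht).le)
      (isClosed_le (by fun_prop) continuous_const) hx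
  have hcl : ∀ x ∈ halfSpaces (t.erase h), ⟪h.1, x⟫ = h.2 → x ∈ closure (halfSpaces t) := by
    intro x hx hx2
    have : openSegment ℝ p x ⊆ halfSpaces t := by
      rintro _ ⟨a, b, ha, hb, hab, rfl⟩
      refine hmem _ (convex_halfSpaces _ (hsub hp) hx ha.le hb.le hab) ?_
      rw [inner_add_right, inner_smul_right, inner_smul_right, hx2]
      calc a * ⟪h.1, p⟫ + b * h.2 < a * h.2 + b * h.2 := by
            linarith [mul_lt_mul_of_pos_left hp2 ha]
        _ = h.2 := by rw [← add_mul, hab, one_mul]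
    have h2 := closure_mono this
    rw [closure_openSegment] at h2
    exact h2 (right_mem_segment ℝ p x)
  have hface : ∀ x ∈ halfSpaces (t.erase h), ⟪h.1, x⟫ = h.2 →
      x ∈ {x | x ∈ closure (halfSpaces t) ∧
        ∀ y ∈ closure (halfSpaces t), ⟪h.1, y⟫ ≤ ⟪h.1, x⟫} := fun x hx hx2 =>
    ⟨hcl x hx hx2, fun y hy => hx2 ▸ hle y hy⟩
  have hval : ∀ x ∈ {x | x ∈ closure (halfSpaces t) ∧
      ∀ y ∈ closure (halfSpaces t), ⟪h.1, y⟫ ≤ ⟪h.1, x⟫}, ⟪h.1, x⟫ = h.2 := fun x hx =>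
    le_antisymm (hle x hx.1) (hz2 ▸ hx.2 z (hcl z hzE hz2))
  refine ⟨_, ⟨hnorm, rfl, ⟨z, hface z hzE hz2⟩, ?_⟩, hval⟩
  have hspan : vectorSpan ℝ {x | x ∈ closure (halfSpaces t) ∧
      ∀ y ∈ closure (halfSpaces t), ⟪h.1, y⟫ ≤ ⟪h.1, x⟫} = (Submodule.span ℝ {h.1})ᗮ := by
    refine le_antisymm (Submodule.span_le.2 ?_) fun d hd => ?_
    · rintro _ ⟨a, ha, b, hb, rfl⟩
      rw [SetLike.mem_coe, Submodule.mem_orthogonal_singleton_iff_inner_right]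
      beta_reduce
      rw [vsub_eq_sub, inner_sub_right, hval a ha, hval b hb, sub_self]
    · rw [Submodule.mem_orthogonal_singleton_iff_inner_right] at hd
      obtain ⟨r, hr, hball⟩ := Metric.isOpen_iff.1 (isOpen_halfSpaces (t.erase h)) z hzE
      have hs : 0 < r / (‖d‖ + 1) := by positivity
      have hzd : z + (r / (‖d‖ + 1)) • d ∈ halfSpaces (t.erase h) := by
        refine hball ?_
        rw [Metric.mem_ball, dist_self_add_left, norm_smul, Real.norm_of_nonneg hs.le,
          div_mul_eq_mul_div, div_lt_iff₀ (by positivity)]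
        linarith
      have h1 := vsub_mem_vectorSpan ℝ
        (hface _ hzd (by rw [inner_add_right, inner_smul_right, hd, hz2]; ring))
        (hface z hzE hz2)
      rw [vsub_eq_sub, add_sub_cancel_left] at h1
      exact (Submodule.smul_mem_iff _ hs.ne').1 h1
  rw [hspan]
  have h1 := Submodule.finrank_add_finrank_orthogonal (Submodule.span ℝ {h.1})
  rw [finrank_span_singleton (by rw [← norm_ne_zero_iff, hnorm]; norm_num),
    finrank_euclideanSpace_fin] at h1
  omega

open Classical in
lemma IsOpenConvexPolyhedron.exists_facets (hP : IsOpenConvexPolyhedron P) :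
    ∃ t : Finset (EuclideanSpace ℝ (Fin n) × ℝ), P = halfSpaces t ∧
      ∀ h ∈ t, ∃ F, IsFacet P F h.1 ∧ ∀ y ∈ F, ⟪h.1, y⟫ = h.2 := by
  obtain ⟨hne, s, hs, hPs⟩ := hP
  set s' := s.image fun h => (‖h.1‖⁻¹ • h.1, ‖h.1‖⁻¹ * h.2) with hs'
  have hP' : P = halfSpaces s' := by
    rw [hPs]
    ext x
    simp only [halfSpaces, hs', mem_ofPred_eq, Finset.forall_mem_image]
    refine forall₂_congr fun h hh => ?_
    rw [real_inner_smul_left, mul_lt_mul_iff_right₀ (inv_pos.2 (norm_pos_iff.2 (hs h hh)))]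
  obtain ⟨t, hts, ht, hmin⟩ := exists_irredundant_halfSpaces s'
  refine ⟨t, hP'.trans ht.symm, fun h hh => ?_⟩
  have hnorm : ‖h.1‖ = 1 := by
    obtain ⟨g, hg, rfl⟩ := Finset.mem_image.1 (hts hh)
    exact norm_smul_inv_norm (𝕜 := ℝ) (hs g hg)
  rw [hP'.trans ht.symm] at hne ⊢
  exact exists_isFacet_of_irredundant hne hh hnorm (hmin h hh)

/-- The largest value on `closure Ω` of a linear functional is attained on the boundary. -/
lemma exists_mem_frontier_isMaxOn_inner (hΩo : IsOpen Ω) (hΩb : Bornology.IsBounded Ω)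
    (hΩn : Ω.Nonempty) (hν : ‖ν‖ = 1) :
    ∃ x ∈ frontier Ω, ∀ y ∈ closure Ω, ⟪ν, y⟫ ≤ ⟪ν, x⟫ := by
  obtain ⟨x, hx, hmax⟩ := hΩb.isCompact_closure.exists_isMaxOn hΩn.closure
    (f := fun y => ⟪ν, y⟫) (by fun_prop)
  refine ⟨x, ?_, fun y hy => hmax hy⟩
  rw [hΩo.frontier_eq]
  refine ⟨hx, fun hxΩ => ?_⟩
  obtain ⟨r, hr, hball⟩ := Metric.isOpen_iff.1 hΩo x hxΩ
  have h1 : x + (r / 2) • ν ∈ Ω := hball (by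
    rw [Metric.mem_ball, dist_self_add_left, norm_smul, hν, Real.norm_of_nonneg (by positivity)]
    linarith)
  have h2 : ⟪ν, x + (r / 2) • ν⟫ ≤ ⟪ν, x⟫ := hmax (subset_closure h1)
  rw [inner_add_right, inner_smul_right, real_inner_self_eq_norm_sq, hν] at h2
  linarith

/-! ### The gap estimate -/

/-- The one-sided estimate; the other one follows by changing the signs of `f`, `u` and `v`. -/
lemma IsWeakSolution.ae_zeroExtend_sub_le (hn : 1 ≤ n) (hΩo : IsOpen Ω) (hΩc : Convex ℝ Ω)
    (hΩb : Bornology.IsBounded Ω) (hP : IsInscribedPolyhedron Ω P)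
    {f u v : EuclideanSpace ℝ (Fin n) → ℝ} (hf : MemLp f ∞ (volume.restrict Ω)) {C : ℝ}
    (hC : 0 ≤ C) (hfC : ∀ᵐ x ∂(volume.restrict Ω), |f x| ≤ C)
    (hu : IsWeakSolution Ω f u) (hv : IsWeakSolution P f v) :
    ∀ᵐ x ∂(volume.restrict Ω), zeroExtend Ω u x - zeroExtend P v x ≤
      1 / 2 * Metric.diam Ω * gap Ω P * C := by
  obtain ⟨t, hPt, hfacet⟩ := hP.polyhedron.exists_facets
  have hPo : IsOpen P := hPt ▸ isOpen_halfSpaces t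
  have hPc : Convex ℝ P := hPt ▸ convex_halfSpaces t
  have hΩn : Ω.Nonempty := closure_nonempty_iff.1 (hP.polyhedron.1.mono hP.subset_closure)
  have hPΩ : P ⊆ Ω := by
    have h1 := interior_maximal hP.subset_closure hPo
    rwa [hΩc.interior_closure_eq_interior_of_nonempty_interior (by rwa [hΩo.interior_eq]),
      hΩo.interior_eq] at h1
  have hPb := hΩb.subset hPΩ
  set D := Metric.diam Ω with hD
  have hD0 : 0 ≤ D := Metric.diam_nonneg
  set δ := gap Ω P with hδ
  -- The barrier for `Ω` at a facet; the maximum of the normal on `closure Ω` exceeds its value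
  -- `h.2` on the facet by at most the gap.
  have hA : ∀ h ∈ t, ∀ᵐ x ∂(volume.restrict Ω), u x ≤ C / 2 * D * (δ + (h.2 - ⟪h.1, x⟫)) := by
    intro h hh
    obtain ⟨F, hF, hFv⟩ := hfacet h hh
    obtain ⟨x₀, hx₀, hmax⟩ := exists_mem_frontier_isMaxOn_inner hΩo hΩb hΩn hF.norm_normal
    have hgap := hF.le_gap hΩb hPc hP.subset_closure hx₀
    rw [inner_sub_right, hFv _ (hF.barycenter_mem hPc hPb)] at hgap
    have hbar := hu.ae_le_barrier hΩo hΩb hf hF.norm_normal (C := C) (m := ⟪h.1, x₀⟫) (D := D) hC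
      (hfC.mono fun x hx => (le_abs_self _).trans hx) (fun x hx => hmax x (subset_closure hx))
      (fun x hx => by
        rw [← inner_sub_right, hD, ← Metric.diam_closure]
        calc ⟪h.1, x₀ - x⟫ ≤ ‖h.1‖ * ‖x₀ - x‖ := real_inner_le_norm _ _
          _ = dist x₀ x := by rw [hF.norm_normal, one_mul, dist_eq_norm]
          _ ≤ _ := Metric.dist_le_diam_of_mem hΩb.closure (frontier_subset_closure hx₀)
            (subset_closure hx))
    filter_upwards [hbar] with x hx
    refine hx.trans (mul_le_mul_of_nonneg_left ?_ (by positivity))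
    linarith
  have hfP : ∀ᵐ x ∂(volume.restrict P), |f x| ≤ C := ae_restrict_of_ae_restrict_of_subset hPΩ hfC
  -- Near a facet `v` is not much below zero; no sign of `v` is known.
  have hB : ∀ h ∈ t, ∀ᵐ x ∂(volume.restrict P), -v x ≤ C / 2 * D * (h.2 - ⟪h.1, x⟫) := by
    intro h hh
    obtain ⟨F, hF, hFv⟩ := hfacet h hh
    obtain ⟨y, hy⟩ := hF.nonempty
    have hyΩ : y ∈ closure Ω := by
      have hy' := hy
      rw [hF.eq_face] at hy'
      exact closure_minimal hP.subset_closure isClosed_closure hy'.1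
    refine hv.neg.ae_le_barrier hPo hPb (hf.mono_measure (Measure.restrict_mono_set _ hPΩ)).neg
      hF.norm_normal hC (hfP.mono fun x hx => (neg_le_abs _).trans hx) (fun x hx => ?_)
      (fun x hx => ?_)
    · rw [hPt] at hx
      exact (hx h hh).le
    · rw [← hFv y hy, ← inner_sub_right, hD, ← Metric.diam_closure]
      calc ⟪h.1, y - x⟫ ≤ ‖h.1‖ * ‖y - x‖ := real_inner_le_norm _ _
        _ = dist y x := by rw [hF.norm_normal, one_mul, dist_eq_norm]
        _ ≤ _ := Metric.dist_le_diam_of_mem hΩb.closure hyΩ (subset_closure (hPΩ hx))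
  have hA' : ∀ᵐ x ∂(volume.restrict Ω), ∀ h ∈ t, u x ≤ C / 2 * D * (δ + (h.2 - ⟪h.1, x⟫)) :=
    (Finset.eventually_all t).2 hA
  have hB' : ∀ᵐ x ∂(volume.restrict P), ∀ h ∈ t, -v x ≤ C / 2 * D * (h.2 - ⟪h.1, x⟫) :=
    (Finset.eventually_all t).2 hB
  have hA'P := ae_restrict_of_ae_restrict_of_subset hPΩ hA'
  have hmain : ∀ η : ℝ, 0 < η → ∀ᵐ x ∂(volume.restrict P),
      u x ≤ v x + C / 2 * D * (δ + 2 * η) := by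
    intro η hη
    set K : Set (EuclideanSpace ℝ (Fin n)) :=
      closure P ∩ ⋂ h ∈ t, {x | ⟪h.1, x⟫ ≤ h.2 - η} with hK
    have hKc : IsCompact K := hPb.isCompact_closure.inter_right
      (isClosed_biInter fun h _ => isClosed_le (by fun_prop) continuous_const)
    have hKP : K ⊆ P := by
      intro x hx
      rw [hPt]
      intro h hh
      have : ⟪h.1, x⟫ ≤ h.2 - η := mem_iInter₂.1 hx.2 h hh
      linarith
    refine hu.ae_le_add_of_ae_le_add_off_compact hΩo hΩb hPo hPΩ hv
      (ν := EuclideanSpace.single ⟨0, hn⟩ 1) (by simp) hKc hKP ?_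
    filter_upwards [hA'P, hB', ae_restrict_mem hPo.measurableSet] with x hxA hxB hxP hxK
    obtain ⟨h, hh, hlt⟩ : ∃ h ∈ t, h.2 - η < ⟪h.1, x⟫ := by
      by_contra! hcon
      exact hxK ⟨subset_closure hxP, mem_iInter₂.2 hcon⟩
    have h1 : C / 2 * D * (h.2 - ⟪h.1, x⟫) ≤ C / 2 * D * η :=
      mul_le_mul_of_nonneg_left (by linarith) (by positivity)
    linarith [hxA h hh, hxB h hh]
  have hlim : ∀ᵐ x ∂(volume.restrict P), u x ≤ v x + C / 2 * D * δ := by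
    have h1 := ae_all_iff.2 fun k : ℕ => hmain (1 / ((k : ℝ) + 1)) Nat.one_div_pos_of_nat
    filter_upwards [h1] with x hx
    have h2 : Tendsto (fun k : ℕ => v x + C / 2 * D * (δ + 2 * (1 / ((k : ℝ) + 1)))) atTop
        (𝓝 (v x + C / 2 * D * (δ + 2 * 0))) :=
      (((tendsto_one_div_add_atTop_nhds_zero_nat.const_mul 2).const_add δ).const_mul _).const_add _
    rw [mul_zero, add_zero] at h2
    exact ge_of_tendsto' h2 hx
  rw [ae_restrict_iff' hPo.measurableSet] at hlim
  filter_upwards [hA', ae_restrict_of_ae hlim, ae_restrict_mem hΩo.measurableSet] with x hxA hxP hxΩ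
  have hux : zeroExtend Ω u x = u x := indicator_of_mem hxΩ u
  rw [hux]
  by_cases hx : x ∈ P
  · have hvx : zeroExtend P v x = v x := indicator_of_mem hx v
    rw [hvx]
    linarith [hxP hx]
  · have hvx : zeroExtend P v x = 0 := indicator_of_notMem hx v
    obtain ⟨h, hh, hle⟩ : ∃ h ∈ t, h.2 ≤ ⟪h.1, x⟫ := by
      by_contra! hcon
      exact hx (hPt ▸ hcon)
    have h1 : C / 2 * D * (h.2 - ⟪h.1, x⟫) ≤ 0 :=
      mul_nonpos_of_nonneg_of_nonpos (by positivity) (by linarith)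
    rw [hvx]
    linarith [hxA h hh]

end Geometry

end PoissonGap

theorem lemma4p2 (n : ℕ) (hn : 1 ≤ n) (Ω P : Set (EuclideanSpace ℝ (Fin n)))
    (hΩ_open : IsOpen Ω) (hΩ_convex : Convex ℝ Ω) (hΩ_bounded : Bornology.IsBounded Ω)
    (hP : PoissonGap.IsInscribedPolyhedron Ω P)
    (f u v : EuclideanSpace ℝ (Fin n) → ℝ)
    (hf : MemLp f ∞ (volume.restrict Ω))
    (hu : PoissonGap.IsWeakSolution Ω f u)
    (hv : PoissonGap.IsWeakSolution P f v) :
    eLpNorm (fun x => PoissonGap.zeroExtend Ω u x - PoissonGap.zeroExtend P v x) ∞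
        (volume.restrict Ω) ≤
      ENNReal.ofReal (1 / 2 * Metric.diam Ω * PoissonGap.gap Ω P) *
        eLpNorm f ∞ (volume.restrict Ω) := by
  set C := (eLpNorm f ∞ (volume.restrict Ω)).toReal with hCdef
  have hC : 0 ≤ C := ENNReal.toReal_nonneg
  have hfC : ∀ᵐ x ∂(volume.restrict Ω), |f x| ≤ C := by
    filter_upwards [enorm_ae_le_eLpNormEssSup f (volume.restrict Ω)] with x hx
    rw [← eLpNorm_exponent_top] at hx
    rw [← Real.norm_eq_abs, ← toReal_enorm]
    exact ENNReal.toReal_mono hf.2.ne hx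
  have h1 := hu.ae_zeroExtend_sub_le hn hΩ_open hΩ_convex hΩ_bounded hP hf hC hfC hv
  have h2 := hu.neg.ae_zeroExtend_sub_le hn hΩ_open hΩ_convex hΩ_bounded hP hf.neg hC
    (by simpa using hfC) hv.neg
  rw [← ENNReal.ofReal_toReal hf.2.ne, ← ENNReal.ofReal_mul' hC, eLpNorm_exponent_top]
  refine eLpNormEssSup_le_of_ae_bound ?_
  have hneg : ∀ (U : Set (EuclideanSpace ℝ (Fin n))) (a : EuclideanSpace ℝ (Fin n) → ℝ) x,
      PoissonGap.zeroExtend U (fun x => -a x) x = -PoissonGap.zeroExtend U a x :=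
    fun U a x => congrFun (Set.indicator_neg U a) x
  filter_upwards [h1, h2] with x hx1 hx2
  rw [hneg, hneg] at hx2
  rw [Real.norm_eq_abs, abs_le]
  constructor <;> linarith
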